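/- Let $d\ge 2$ and let $\Omega_0\subset\Omega_1$ be bounded open sets in $\mathbb{R}^d$. For an open set $\Omega\subset\mathbb{R}^d$ let $H^1_0(\Omega)$ be the closure of $C_c^\infty(\Omega)$ in $H^1(\mathbb{R}^d)$ (functions being extended by zero outside $\Omega$). For a bounded open set $\Omega$ and $f\in L^2(\mathbb{R}^d)$ let $u_{\Omega,f}\in H^1_0(\Omega)$ be the unique weak solution of $-\Delta u=f$ in $\Omega$, $u\in H^1_0(\Omega)$, that is, $$\int\nabla u_{\Omega,f}\cdot\nabla\varphi\,dx=\int f\varphi\,dx\qquad\text{for all }\varphi\in H^1_0(\Omega).$$ A sequence $(A_n)$ of bounded open sets $\gamma$-converges to a bounded open set $A$ if for every $f\in L^2(\mathbb{R}^d)$ the functions $u_{A_n,f}$ converge weakly in $H^1(\mathbb{R}^d)$ to $u_{A,f}$. Then there is a family $(\Omega_t)_{t\in[0,1]}$ of open sets, with the given sets $\Omega_0$ and $\Omega_1$ as its members at $t=0$ and $t=1$, such that $\Omega_s\subset\Omega_t$ for all $0\le s<t\le1$, and which is $\gamma$-continuous: whenever $t_n\to t$ in $[0,1]$, the sets $\Omega_{t_n}$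 $\gamma$-converge to $\Omega_t$. Moreover, for every $f\in L^2(\mathbb{R}^d)$ the map $t\mapsto u_{\Omega_t,f}$ is continuous from $[0,1]$ to $H^1(\mathbb{R}^d)$ with its norm. -/

import Mathlib

open MeasureTheory Filter Topology
open scoped ContDiff

noncomputable section

namespace Dirichlet

/-- Euclidean space `ℝ^d`. -/
abbrev E (d : ℕ) : Type := EuclideanSpace ℝ (Fin d)

/-- The space `L²(ℝ^d)` of real functions. -/
abbrev L2 (d : ℕ) : Type := Lp ℝ 2 (volume : Measure (E d))

/-- The space `L²(ℝ^d; ℝ^d)` of vector fields. -/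
abbrev L2Vec (d : ℕ) : Type := Lp (E d) 2 (volume : Measure (E d))

/-- `φ ∈ C_c^∞(Ω)`: smooth on `ℝ^d`, with compact support contained in `Ω`. -/
def IsTestFunction {d : ℕ} (Ω : Set (E d)) (φ : E d → ℝ) : Prop :=
  ContDiff ℝ ∞ φ ∧ HasCompactSupport φ ∧ tsupport φ ⊆ Ω

/-- `g` is the weak (distributional) gradient of `u` on `ℝ^d`. -/
def IsWeakGradient {d : ℕ} (u : L2 d) (g : L2Vec d) : Prop :=
  ∀ φ : E d → ℝ, IsTestFunction Set.univ φ → ∀ v : E d,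
    ∫ x, u x * fderiv ℝ φ x v = - ∫ x, inner ℝ (g x) v * φ x

theorem IsTestFunction.memLp {d : ℕ} {Ω : Set (E d)} {φ : E d → ℝ}
    (h : IsTestFunction Ω φ) : MemLp φ 2 (volume : Measure (E d)) :=
  h.1.continuous.memLp_of_hasCompactSupport h.2.1

theorem IsTestFunction.memLp_fderiv {d : ℕ} {Ω : Set (E d)} {φ : E d → ℝ}
    (h : IsTestFunction Ω φ) (v : E d) :
    MemLp (fun x => fderiv ℝ φ x v) 2 (volume : Measure (E d)) := by
  refine Continuous.memLp_of_hasCompactSupport ?_ (h.2.1.fderiv_apply ℝ v)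
  exact (h.1.continuous_fderiv (by simp)).clm_apply continuous_const

theorem IsTestFunction.integrable_left {d : ℕ} {Ω : Set (E d)} {φ : E d → ℝ}
    (h : IsTestFunction Ω φ) (v : E d) (u : L2 d) :
    Integrable (fun x => u x * fderiv ℝ φ x v) :=
  (Lp.memLp u).integrable_mul (h.memLp_fderiv v)

theorem IsTestFunction.integrable_right {d : ℕ} {Ω : Set (E d)} {φ : E d → ℝ}
    (h : IsTestFunction Ω φ) (v : E d) (g : L2Vec d) :
    Integrable (fun x => inner ℝ (g x) v * φ x) :=
  ((Lp.memLp g).inner_const v).integrable_mul h.memLp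

/-- The Sobolev space `H¹(ℝ^d)`: a function of `L²` together with its weak gradient in `L²`,
with the norm `(‖u‖² + ‖∇u‖²)^(1/2)`. -/
def H1 (d : ℕ) : Submodule ℝ (WithLp 2 (L2 d × L2Vec d)) where
  carrier := {w | IsWeakGradient w.fst w.snd}
  zero_mem' := by
    intro φ hφ v
    have h1 : (fun x => ((0 : L2 d) : E d → ℝ) x * fderiv ℝ φ x v) =ᵐ[volume] fun _ => 0 := by
      filter_upwards with x
      simp
    have h2 : (fun x => inner ℝ (((0 : L2Vec d) : E d → E d) x) v * φ x)
        =ᵐ[volume] fun _ => 0 := by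
      filter_upwards with x
      simp
    simp only [WithLp.zero_fst, WithLp.zero_snd]
    rw [integral_congr_ae h1, integral_congr_ae h2]
    simp
  add_mem' := by
    intro a b ha hb φ hφ v
    have h1 : (fun x => ((a.fst + b.fst : L2 d) : E d → ℝ) x * fderiv ℝ φ x v)
        =ᵐ[volume] fun x => a.fst x * fderiv ℝ φ x v + b.fst x * fderiv ℝ φ x v := by
      filter_upwards [Lp.coeFn_add a.fst b.fst] with x hx
      simp only [hx, Pi.add_apply, add_mul]
    have h2 : (fun x => inner ℝ (((a.snd + b.snd : L2Vec d) : E d → E d) x) v * φ x)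
        =ᵐ[volume] fun x => inner ℝ (a.snd x) v * φ x + inner ℝ (b.snd x) v * φ x := by
      filter_upwards [Lp.coeFn_add a.snd b.snd] with x hx
      simp only [hx, Pi.add_apply, inner_add_left, add_mul]
    simp only [WithLp.add_fst, WithLp.add_snd]
    rw [integral_congr_ae h1, integral_congr_ae h2,
      integral_add (hφ.integrable_left v _) (hφ.integrable_left v _),
      integral_add (hφ.integrable_right v _) (hφ.integrable_right v _), ha φ hφ v, hb φ hφ v]
    ring
  smul_mem' := by
    intro c a ha φ hφ v
    have h1 : (fun x => ((c • a.fst : L2 d) : E d → ℝ) x * fderiv ℝ φ x v)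
        =ᵐ[volume] fun x => c * (a.fst x * fderiv ℝ φ x v) := by
      filter_upwards [Lp.coeFn_smul c a.fst] with x hx
      simp only [hx, Pi.smul_apply, smul_eq_mul, mul_assoc]
    have h2 : (fun x => inner ℝ (((c • a.snd : L2Vec d) : E d → E d) x) v * φ x)
        =ᵐ[volume] fun x => c * (inner ℝ (a.snd x) v * φ x) := by
      filter_upwards [Lp.coeFn_smul c a.snd] with x hx
      simp only [hx, Pi.smul_apply, real_inner_smul_left, mul_assoc]
    simp only [WithLp.smul_fst, WithLp.smul_snd]
    rw [integral_congr_ae h1, integral_congr_ae h2, integral_const_mul, integral_const_mul,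
      ha φ hφ v]
    ring

/-- The underlying `L²` function of an element of `H¹(ℝ^d)`. -/
def fn {d : ℕ} (u : H1 d) : L2 d := (u : WithLp 2 (L2 d × L2Vec d)).fst

/-- The weak gradient of an element of `H¹(ℝ^d)`. -/
def grad {d : ℕ} (u : H1 d) : L2Vec d := (u : WithLp 2 (L2 d × L2Vec d)).snd

/-- The subspace `C_c^∞(Ω)` of `H¹(ℝ^d)`. -/
def testSpace {d : ℕ} (Ω : Set (E d)) : Submodule ℝ (H1 d) where
  carrier := {u | ∃ φ : E d → ℝ, IsTestFunction Ω φ ∧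
    (fn u : E d → ℝ) =ᵐ[volume] φ ∧ (grad u : E d → E d) =ᵐ[volume] gradient φ}
  zero_mem' := by
    refine ⟨0, ⟨contDiff_const, HasCompactSupport.zero, by simp [tsupport]⟩,
      Lp.coeFn_zero ℝ 2 _, ?_⟩
    refine (Lp.coeFn_zero (E d) 2 _).trans (Eventually.of_forall fun x => ?_)
    exact (gradient_const x (0 : ℝ)).symm
  add_mem' := by
    rintro a b ⟨φ, hφ, ha, ha'⟩ ⟨ψ, hψ, hb, hb'⟩
    refine ⟨φ + ψ, ⟨hφ.1.add hψ.1, hφ.2.1.add hψ.2.1,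
      (tsupport_add φ ψ).trans (Set.union_subset hφ.2.2 hψ.2.2)⟩,
      (Lp.coeFn_add (fn a) (fn b)).trans (ha.add hb), ?_⟩
    refine (Lp.coeFn_add (grad a) (grad b)).trans ((ha'.add hb').trans
      (Eventually.of_forall fun x => ?_))
    have h1 := hφ.1.differentiable (by simp) x
    have h2 := hψ.1.differentiable (by simp) x
    simp [gradient, fderiv_add h1 h2]
  smul_mem' := by
    rintro c a ⟨φ, hφ, ha, ha'⟩
    refine ⟨c • φ, ⟨hφ.1.const_smul c, hφ.2.1.smul_left (f := fun _ => c),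
      (tsupport_smul_subset_right (fun _ => c) φ).trans hφ.2.2⟩,
      (Lp.coeFn_smul c (fn a)).trans (ha.const_smul c), ?_⟩
    refine (Lp.coeFn_smul c (grad a)).trans ((ha'.const_smul c).trans
      (Eventually.of_forall fun x => ?_))
    have h1 := hφ.1.differentiable (by simp) x
    simp [gradient, fderiv_const_smul h1 c]

/-- The space `H¹₀(Ω)`, whose elements are extended by zero outside `Ω`: the closure of
`C_c^∞(Ω)` in `H¹(ℝ^d)`. -/
def H10 {d : ℕ} (Ω : Set (E d)) : Submodule ℝ (H1 d) := (testSpace Ω).topologicalClosure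

/-- `u` is a weak solution of `-Δu = f` in `Ω`, `u ∈ H¹₀(Ω)`. -/
def IsSolution {d : ℕ} (Ω : Set (E d)) (f : L2 d) (u : H1 d) : Prop :=
  u ∈ H10 Ω ∧ ∀ φ ∈ H10 Ω, ∫ x, inner ℝ (grad u x) (grad φ x) = ∫ x, f x * fn φ x

/-- `u` is the (one and only) weak solution of `-Δu = f` in `Ω`, `u ∈ H¹₀(Ω)`. -/
def IsUniqueSolution {d : ℕ} (Ω : Set (E d)) (f : L2 d) (u : H1 d) : Prop :=
  IsSolution Ω f u ∧ ∀ v, IsSolution Ω f v → v = u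

/-- Weak convergence of sequences in `H¹(ℝ^d)`. -/
def WeakH1Tendsto {d : ℕ} (u : ℕ → H1 d) (w : H1 d) : Prop :=
  ∀ ℓ : H1 d →L[ℝ] ℝ, Tendsto (fun n => ℓ (u n)) atTop (𝓝 (ℓ w))

/-- The sequence `Ω n` γ-converges to `Ω'`: for every `f ∈ L²(ℝ^d)` the Dirichlet problems with
right-hand side `f` on all these sets have unique solutions, and those on `Ω n` converge weakly in
`H¹(ℝ^d)` to the one on `Ω'`. -/
def GammaTendsto {d : ℕ} (Ω : ℕ → Set (E d)) (Ω' : Set (E d)) : Prop :=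
  ∀ f : L2 d, ∃ (u : ℕ → H1 d) (w : H1 d),
    (∀ n, IsUniqueSolution (Ω n) f (u n)) ∧ IsUniqueSolution Ω' f w ∧ WeakH1Tendsto u w

/-- The family `Ω t`, `t ∈ [0,1]`, is γ-continuous. -/
def GammaContinuous {d : ℕ} (Ω : unitInterval → Set (E d)) : Prop :=
  ∀ (t : ℕ → unitInterval) (t' : unitInterval), Tendsto t atTop (𝓝 t') →
    GammaTendsto (fun n => Ω (t n)) (Ω t')

end Dirichlet

end

/-!
Take a curve `γ : [0,1] → ℝ^d` whose range covers `Ω₁` and which ends outside `Ω₁`, and set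
`Ω_t = Ω₀ ∪ (Ω₁ \ γ([t,1]))`. This family increases from `Ω₀` to `Ω₁`, and each `Ω_t` is the union
of the earlier sets up to the point `γ(t)`, so `H¹₀(Ω_t)` is the closure of the union of the
`H¹₀(Ω_s)`, `s < t`. From the right, `Ω_s \ Ω_t` shrinks into every neighbourhood of the single
point `γ(t)`, so `H¹₀(Ω_t)` is the intersection of the `H¹₀(Ω_s)`, `s > t`, because points have zero
capacity when `d ≥ 2`: the critical Hardy inequality with a logarithmic weight makes multiplication
by logarithmic cutoffs bounded on `H¹₀` of a ball, uniformly in the scale of the cutoff, and what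
they cut out lives on a small ball, hence is almost orthogonal to any given `v ∈ H¹(ℝ^d)`.

A monotone family of closed subspaces without jumps has strongly continuous orthogonal projections.
By the Poincaré inequality the gradient embeds `H¹₀(Ω₁)` into `L²`, and there `∇u_{Ω_t,f}` is the
projection of `∇u_{Ω₁,f}` onto `∇H¹₀(Ω_t)`, so `u_{Ω_t,f}` is continuous in `t`.
-/

open scoped InnerProductSpace

noncomputable section

namespace Dirichlet

section Projection

variable {𝕜 H T : Type*} [RCLike 𝕜] [NormedAddCommGroup H] [InnerProductSpace 𝕜 H]
  [CompleteSpace H]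

theorem tendsto_starProjection_atTop_iInf {ι : Type*} [Preorder ι] {W : ι → Submodule 𝕜 H}
    [∀ i, (W i).HasOrthogonalProjection] [(⨅ i, W i).HasOrthogonalProjection]
    (hW : Antitone W) (x : H) :
    Tendsto (fun i => (W i).starProjection x) atTop (𝓝 ((⨅ i, W i).starProjection x)) := by
  have h := Submodule.starProjection_tendsto_closure_iSup (fun i => (W i)ᗮ)
    (fun _ _ hij => Submodule.orthogonal_le (hW hij)) x
  have hperp : (⨆ i, (W i)ᗮ).topologicalClosure = (⨅ i, W i)ᗮ := by
    rw [← Submodule.orthogonal_orthogonal_eq_closure, ← Submodule.iInf_orthogonal]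
    simp only [Submodule.orthogonal_orthogonal]
  simp only [hperp, Submodule.starProjection_orthogonal_val] at h
  simpa only [sub_sub_cancel] using h.const_sub x

variable [LinearOrder T] [TopologicalSpace T] [OrderTopology T] [DenselyOrdered T]
  {W : T → Submodule 𝕜 H} [∀ t, (W t).HasOrthogonalProjection]

theorem continuousWithinAt_starProjection_Iio (hW : Monotone W) {t : T}
    (hleft : W t ≤ (⨆ s : Set.Iio t, W s).topologicalClosure) (x : H) :
    ContinuousWithinAt (fun s => (W s).starProjection x) (Set.Iio t) t := by
  have hclosed : IsClosed (W t : Set H) := by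
    rw [← Submodule.orthogonal_orthogonal (W t)]
    exact Submodule.isClosed_orthogonal _
  have hsup : (⨆ s : Set.Iio t, W s).topologicalClosure = W t :=
    le_antisymm (Submodule.topologicalClosure_minimal _ (iSup_le fun s => hW s.2.le) hclosed) hleft
  have h := Submodule.starProjection_tendsto_closure_iSup (fun s : Set.Iio t => W s)
    (fun _ _ hrs => hW hrs) x
  simp only [hsup] at h
  exact (tendsto_comp_coe_Iio_atTop (f := fun s => (W s).starProjection x)).mp h

theorem continuousWithinAt_starProjection_Ioi (hW : Monotone W) {t : T}
    (hright : ⨅ s : Set.Ioi t, W s ≤ W t) (x : H) :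
    ContinuousWithinAt (fun s => (W s).starProjection x) (Set.Ioi t) t := by
  have hinf : ⨅ s : (Set.Ioi t)ᵒᵈ, W (OrderDual.ofDual s).1 = W t :=
    le_antisymm hright (le_iInf fun s => hW (OrderDual.ofDual s).2.le)
  have : (⨅ s : (Set.Ioi t)ᵒᵈ, W (OrderDual.ofDual s).1).HasOrthogonalProjection :=
    hinf ▸ inferInstance
  have h := tendsto_starProjection_atTop_iInf
    (W := fun s : (Set.Ioi t)ᵒᵈ => W (OrderDual.ofDual s).1) (fun _ _ hrs => hW hrs) x
  simp only [hinf] at h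
  exact (tendsto_comp_coe_Ioi_atBot (f := fun s => (W s).starProjection x)).mp h

theorem continuous_starProjection_of_monotone (hW : Monotone W)
    (hleft : ∀ t, ¬IsMin t → W t ≤ (⨆ s : Set.Iio t, W s).topologicalClosure)
    (hright : ∀ t, ¬IsMax t → ⨅ s : Set.Ioi t, W s ≤ W t) (x : H) :
    Continuous fun t => (W t).starProjection x := by
  refine continuous_iff_continuousAt.mpr fun t => ?_
  refine continuousAt_iff_continuous_left'_right'.mpr ⟨?_, ?_⟩
  · by_cases ht : IsMin t
    · simp [ContinuousWithinAt, ht.Iio_eq]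
    · exact continuousWithinAt_starProjection_Iio hW (hleft t ht) x
  · by_cases ht : IsMax t
    · simp [ContinuousWithinAt, ht.Ioi_eq]
    · exact continuousWithinAt_starProjection_Ioi hW (hright t ht) x

end Projection

section Galerkin

variable {H F T : Type*} [NormedAddCommGroup H] [InnerProductSpace ℝ H] [NormedAddCommGroup F]
  [InnerProductSpace ℝ F] {G : H →L[ℝ] F} {U V : Submodule ℝ H} {ℓ : H →L[ℝ] ℝ} {C : ℝ} {u v : H}

/-- `u` solves the Galerkin problem on the subspace `V` for the energy form `⟪G u, G v⟫` with load
`ℓ`. -/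
def IsGalerkinSolution (G : H →L[ℝ] F) (V : Submodule ℝ H) (ℓ : H →L[ℝ] ℝ) (u : H) : Prop :=
  u ∈ V ∧ ∀ v ∈ V, ⟪G u, G v⟫_ℝ = ℓ v

theorem exists_isGalerkinSolution [CompleteSpace H] (hV : IsClosed (V : Set H)) (hC₀ : 0 < C)
    (hC : ∀ v ∈ V, ‖v‖ ≤ C * ‖G v‖) (ℓ : H →L[ℝ] ℝ) : ∃ u, IsGalerkinSolution G V ℓ u := by
  have : CompleteSpace V := hV.completeSpace_coe
  let B : V →L[ℝ] V →L[ℝ] ℝ := (innerSL ℝ).bilinearComp (G.comp V.subtypeL) (G.comp V.subtypeL)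
  have hB : IsCoercive B := by
    refine ⟨(C ^ 2)⁻¹, by positivity, fun v => ?_⟩
    have hv : ‖v‖ ^ 2 ≤ C ^ 2 * ‖G v‖ ^ 2 := by
      rw [← mul_pow]
      exact pow_le_pow_left₀ (norm_nonneg _) (hC v v.2) 2
    change _ ≤ ⟪G v, G v⟫_ℝ
    rwa [real_inner_self_eq_norm_sq, mul_assoc, inv_mul_le_iff₀ (by positivity), ← sq]
  let u : V := hB.continuousLinearEquivOfBilin.symm
    ((InnerProductSpace.toDual ℝ V).symm (ℓ.comp V.subtypeL))
  refine ⟨u, u.2, fun v hv => ?_⟩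
  change B u ⟨v, hv⟩ = ℓ.comp V.subtypeL ⟨v, hv⟩
  rw [← hB.continuousLinearEquivOfBilin_apply, ContinuousLinearEquiv.apply_symm_apply,
    InnerProductSpace.toDual_symm_apply]

theorem IsGalerkinSolution.unique (hC : ∀ v ∈ V, ‖v‖ ≤ C * ‖G v‖)
    (hu : IsGalerkinSolution G V ℓ u) (hv : IsGalerkinSolution G V ℓ v) : u = v := by
  have hmem : u - v ∈ V := V.sub_mem hu.1 hv.1
  have hG : G (u - v) = 0 := by
    rw [← inner_self_eq_zero (𝕜 := ℝ)]
    nth_rw 1 [map_sub]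
    rw [inner_sub_left, hu.2 _ hmem, hv.2 _ hmem, sub_self]
  have h := hC _ hmem
  rw [hG, norm_zero, mul_zero] at h
  exact sub_eq_zero.mp (norm_le_zero_iff.mp h)

theorem IsGalerkinSolution.starProjection_map [(V.map G.toLinearMap).HasOrthogonalProjection]
    (hVU : V ≤ U) (hu : IsGalerkinSolution G U ℓ u) (hv : IsGalerkinSolution G V ℓ v) :
    (V.map G.toLinearMap).starProjection (G u) = G v := by
  refine Submodule.eq_starProjection_of_mem_of_inner_eq_zero ⟨v, hv.1, rfl⟩ ?_
  rintro _ ⟨w, hw, rfl⟩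
  change ⟪G u - G v, G w⟫_ℝ = 0
  rw [inner_sub_left, hu.2 w (hVU hw), hv.2 w hw, sub_self]

theorem antilipschitzWith_comp_subtypeL (hC : ∀ v ∈ V, ‖v‖ ≤ C * ‖G v‖) :
    AntilipschitzWith C.toNNReal (G.comp V.subtypeL) :=
  AddMonoidHomClass.antilipschitz_of_bound _ fun v =>
    (hC v v.2).trans (mul_le_mul_of_nonneg_right C.le_coe_toNNReal (norm_nonneg _))

theorem isComplete_map_of_norm_le [CompleteSpace H] (hV : IsClosed (V : Set H))
    (hC : ∀ v ∈ V, ‖v‖ ≤ C * ‖G v‖) : IsComplete (V.map G.toLinearMap : Set F) := by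
  have : CompleteSpace V := hV.completeSpace_coe
  have hrange : (V.map G.toLinearMap : Set F) = Set.range (G.comp V.subtypeL) := by
    ext y
    simp
  rw [hrange]
  exact (antilipschitzWith_comp_subtypeL hC).isComplete_range
    (G.comp V.subtypeL).uniformContinuous

theorem iInf_map_le_map_iInf {ι : Type*} [Nonempty ι] {W : ι → Submodule ℝ H}
    (hWU : ∀ i, W i ≤ U) (hG : Set.InjOn G U) :
    ⨅ i, (W i).map G.toLinearMap ≤ (⨅ i, W i).map G.toLinearMap := by
  refine SetLike.coe_subset_coe.mp ?_
  simp only [Submodule.coe_iInf, Submodule.map_coe]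
  have hunion : ⋃ i, (W i : Set H) ⊆ U :=
    Set.iUnion_subset fun i => SetLike.coe_subset_coe.mpr (hWU i)
  have himage : G '' ⋂ i, (W i : Set H) = ⋂ i, G '' (W i : Set H) :=
    (hG.mono hunion).image_iInter_eq
  exact himage.ge

theorem map_le_topologicalClosure_iSup_map {ι : Type*} {W : ι → Submodule ℝ H}
    (hV : V ≤ (⨆ i, W i).topologicalClosure) :
    V.map G.toLinearMap ≤ (⨆ i, (W i).map G.toLinearMap).topologicalClosure := by
  rw [← Submodule.map_iSup]
  calc V.map G.toLinearMap ≤ (⨆ i, W i).topologicalClosure.map G.toLinearMap :=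
        Submodule.map_mono hV
    _ ≤ ((⨆ i, W i).map G.toLinearMap).topologicalClosure := Submodule.topologicalClosure_map G _

variable [CompleteSpace H] [CompleteSpace F] [LinearOrder T] [TopologicalSpace T] [OrderTopology T]
  [DenselyOrdered T] {W : T → Submodule ℝ H} {u : T → H}

theorem continuous_isGalerkinSolution (hC₀ : 0 < C) (hU : IsClosed (U : Set H))
    (hC : ∀ v ∈ U, ‖v‖ ≤ C * ‖G v‖) (hW : Monotone W) (hWU : ∀ t, W t ≤ U)
    (hclosed : ∀ t, IsClosed (W t : Set H))
    (hleft : ∀ t, ¬IsMin t → W t ≤ (⨆ s : Set.Iio t, W s).topologicalClosure)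
    (hright : ∀ t, ¬IsMax t → ⨅ s : Set.Ioi t, W s ≤ W t)
    (hu : ∀ t, IsGalerkinSolution G (W t) ℓ (u t)) : Continuous u := by
  have hanti := antilipschitzWith_comp_subtypeL hC
  have hinj : Set.InjOn G U := Set.injOn_iff_injective.mpr hanti.injective
  have hcomplete : ∀ t, CompleteSpace ((W t).map G.toLinearMap) := fun t =>
    (isComplete_map_of_norm_le (hclosed t) fun v hv => hC v (hWU t hv)).completeSpace_coe
  obtain ⟨uU, huU⟩ := exists_isGalerkinSolution hU hC₀ hC ℓ
  have hGu : Continuous fun t => G (u t) := by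
    have hproj : (fun t => G (u t)) = fun t => ((W t).map G.toLinearMap).starProjection (G uU) :=
      funext fun t => (huU.starProjection_map (hWU t) (hu t)).symm
    rw [hproj]
    refine continuous_starProjection_of_monotone (fun _ _ hst => Submodule.map_mono (hW hst))
      (fun t ht => map_le_topologicalClosure_iSup_map (hleft t ht)) (fun t ht => ?_) _
    have : Nonempty (Set.Ioi t) := nonempty_subtype.mpr (not_isMax_iff.mp ht)
    exact (iInf_map_le_map_iInf (fun s : Set.Ioi t => hWU s) hinj).trans
      (Submodule.map_mono (hright t ht))
  have hind := (hanti.isUniformInducing (G.comp U.subtypeL).uniformContinuous).isInducing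
  exact continuous_subtype_val.comp
    (hind.continuous_iff (f := fun t => (⟨u t, hWU t (hu t).1⟩ : U)) |>.mpr hGu)

end Galerkin

section SpaceFilling

variable {V : Type*} [NormedAddCommGroup V] [NormedSpace ℝ V] [FiniteDimensional ℝ V]

theorem exists_continuousMap_unitInterval_range_superset {K : Set V} (hK : IsCompact K) :
    ∃ c : C(unitInterval, V), K ⊆ Set.range c := by
  rcases K.eq_empty_or_nonempty with rfl | hne
  · exact ⟨0, Set.empty_subset _⟩
  have : Nonempty K := hne.to_subtype
  have : CompactSpace K := isCompact_iff_compactSpace.mp hK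
  obtain ⟨f, hf, hf_surj⟩ := exists_nat_bool_continuous_surjective_of_compact K
  let g : C(cantorSet, V) := ⟨fun x => f (cantorSetHomeomorphNatToBool x), by fun_prop⟩
  obtain ⟨c, hc⟩ := g.exists_restrict_eq isClosed_cantorSet
  refine ⟨c.restrict unitInterval, fun x hx => ?_⟩
  obtain ⟨b, hb⟩ := hf_surj ⟨x, hx⟩
  let z := cantorSetHomeomorphNatToBool.symm b
  refine ⟨⟨z, cantorSet_subset_unitInterval z.2⟩, ?_⟩
  calc c z = g z := DFunLike.congr_fun hc z
    _ = f b := by simp [g, z]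
    _ = x := congrArg Subtype.val hb

theorem exists_path_range_superset {A : Set V} (hA : Bornology.IsBounded A) (q : V) :
    ∃ (a : V) (γ : Path a q), A ⊆ Set.range γ := by
  have : ProperSpace V := FiniteDimensional.proper_real V
  obtain ⟨c, hc⟩ := exists_continuousMap_unitInterval_range_superset hA.isCompact_closure
  let γ : Path (c 0) (c 1) := ⟨c, rfl, rfl⟩
  refine ⟨c 0, γ.trans (PathConnectedSpace.somePath _ _), ?_⟩
  rw [Path.trans_range]
  exact (subset_closure.trans hc).trans Set.subset_union_left

end SpaceFilling

section Sweep
variable {T X : Type*}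

/-- The domains `Ω₀ ∪ (Ω₁ \ γ([t, ∞)))`, which grow from `Ω₀` to `Ω₁` while the part of the curve
`γ` still to be removed shrinks. -/
def sweep [Preorder T] (Ω₀ Ω₁ : Set X) (γ : T → X) (t : T) : Set X := Ω₀ ∪ (Ω₁ \ γ '' Set.Ici t)

variable {Ω₀ Ω₁ : Set X} {γ : T → X} {t : T}

theorem monotone_sweep [Preorder T] : Monotone (sweep Ω₀ Ω₁ γ) := fun _ _ hst =>
  Set.union_subset_union_right _
    (Set.sdiff_subset_sdiff_right (Set.image_mono (Set.Ici_subset_Ici.mpr hst)))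

theorem sweep_subset [Preorder T] (h : Ω₀ ⊆ Ω₁) (t : T) : sweep Ω₀ Ω₁ γ t ⊆ Ω₁ :=
  Set.union_subset h Set.sdiff_subset

theorem sweep_eq_left [Preorder T] [OrderBot T] (hγ : Ω₁ ⊆ Set.range γ) : sweep Ω₀ Ω₁ γ ⊥ = Ω₀ := by
  simp [sweep, Set.sdiff_eq_empty.mpr hγ]

theorem sweep_eq_right [PartialOrder T] [OrderTop T] (h : Ω₀ ⊆ Ω₁) (hγ : γ ⊤ ∉ Ω₁) :
    sweep Ω₀ Ω₁ γ ⊤ = Ω₁ := by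
  simp [sweep, hγ, h]

variable [TopologicalSpace X] [LinearOrder T] [TopologicalSpace T] [OrderTopology T]

theorem isOpen_sweep [CompactSpace T] [T2Space X] (h₀ : IsOpen Ω₀) (h₁ : IsOpen Ω₁)
    (hγ : Continuous γ) (t : T) : IsOpen (sweep Ω₀ Ω₁ γ t) :=
  h₀.union (h₁.sdiff (isClosed_Ici.isCompact.image hγ).isClosed)

theorem sweep_subset_iUnion_Iio [DenselyOrdered T] [T1Space X] (hγ : Continuous γ)
    (ht : ¬IsMin t) : sweep Ω₀ Ω₁ γ t ⊆ ⋃ s : Set.Iio t, sweep Ω₀ Ω₁ γ s := by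
  obtain ⟨t₀, ht₀⟩ := not_isMin_iff.mp ht
  rintro x (hx | ⟨hx, hxt⟩)
  · exact Set.mem_iUnion.mpr ⟨⟨t₀, ht₀⟩, Or.inl hx⟩
  have hnear : ∀ᶠ r in 𝓝[<] t, γ r ≠ x :=
    hγ.continuousWithinAt.eventually_ne fun h => hxt ⟨t, Set.self_mem_Ici, h⟩
  obtain ⟨r, hr, hrt⟩ := (mem_nhdsLT_iff_exists_Ioo_subset' ht₀).mp hnear
  obtain ⟨s, hrs, hst⟩ := exists_between hr
  refine Set.mem_iUnion.mpr ⟨⟨s, hst⟩, Or.inr ⟨hx, ?_⟩⟩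
  rintro ⟨r', hr', rfl⟩
  rcases lt_or_ge r' t with h | h
  · exact hrt ⟨hrs.trans_le hr', h⟩ rfl
  · exact hxt ⟨r', h, rfl⟩

theorem exists_gt_sweep_diff_subset (hγ : Continuous γ) (ht : ¬IsMax t) {N : Set X}
    (hN : N ∈ 𝓝 (γ t)) : ∃ s > t, sweep Ω₀ Ω₁ γ s \ N ⊆ sweep Ω₀ Ω₁ γ t := by
  obtain ⟨s, hts, hs⟩ := exists_Ico_subset_of_mem_nhds (hγ.continuousAt hN) (not_isMax_iff.mp ht)
  refine ⟨s, hts, ?_⟩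
  rintro x ⟨hx | ⟨hx, hxs⟩, hxN⟩
  · exact Or.inl hx
  refine Or.inr ⟨hx, ?_⟩
  rintro ⟨r, hr, rfl⟩
  rcases lt_or_ge r s with h | h
  · exact hxN (hs ⟨hr, h⟩)
  · exact hxs ⟨r, h, rfl⟩

end Sweep

section RadialHardy

variable {V : Type*} [NormedAddCommGroup V] [InnerProductSpace ℝ V]

theorem neg_two_mul_mul_apply_le (L : V →L[ℝ] ℝ) (c : ℝ) (y : V) :
    -(2 * c * L y) ≤ c ^ 2 * ‖y‖ ^ 2 + ‖L‖ ^ 2 := by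
  have hL : |c * L y| ≤ |c| * ‖y‖ * ‖L‖ := by
    rw [abs_mul, mul_assoc, mul_comm ‖y‖]
    exact mul_le_mul_of_nonneg_left (L.le_opNorm y) (abs_nonneg c)
  have hsq := two_mul_le_add_sq (|c| * ‖y‖) ‖L‖
  rw [mul_pow, sq_abs] at hsq
  linarith [neg_abs_le (c * L y)]

theorem hasFDerivAt_norm_sub_sq (p x : V) :
    HasFDerivAt (fun x => ‖x - p‖ ^ 2) (2 • innerSL ℝ (x - p)) x := by
  simpa using ((hasFDerivAt_id x).sub_const p).norm_sq

theorem fderiv_sq_mul_comp_norm_sub_sq_apply {φ : V → ℝ} {a : ℝ → ℝ} {p x : V}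
    (hφ : DifferentiableAt ℝ φ x) (ha : DifferentiableAt ℝ a (‖x - p‖ ^ 2)) :
    fderiv ℝ (fun x => φ x ^ 2 * a (‖x - p‖ ^ 2)) x (x - p) =
      2 * (φ x * a (‖x - p‖ ^ 2)) * fderiv ℝ φ x (x - p) +
        φ x ^ 2 * (2 * ‖x - p‖ ^ 2 * deriv a (‖x - p‖ ^ 2)) := by
  have hcomp := ha.hasDerivAt.comp_hasFDerivAt x (hasFDerivAt_norm_sub_sq p x)
  have hderiv : HasFDerivAt (fun x => φ x ^ 2 * a (‖x - p‖ ^ 2)) _ x :=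
    (hφ.hasFDerivAt.pow 2).mul hcomp
  rw [hderiv.fderiv]
  simp only [_root_.add_apply, _root_.smul_apply, innerSL_apply_apply, smul_eq_mul,
    real_inner_self_eq_norm_sq, nsmul_eq_mul]
  push_cast
  ring

variable [FiniteDimensional ℝ V] [MeasurableSpace V] [BorelSpace V] {g φ : V → ℝ} {p : V}

theorem integrable_fderiv_apply_sub_add_finrank_mul (hg : ContDiff ℝ 1 g)
    (hc : HasCompactSupport g) (p : V) :
    Integrable fun x => fderiv ℝ g x (x - p) + Module.finrank ℝ V * g x := by
  have h₁ : Continuous fun x => fderiv ℝ g x (x - p) :=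
    (hg.continuous_fderiv one_ne_zero).clm_apply (by fun_prop)
  have h₂ : HasCompactSupport fun x => fderiv ℝ g x (x - p) :=
    (hc.fderiv ℝ).mono fun x hx h => hx (by simp [h])
  exact (h₁.integrable_of_hasCompactSupport h₂).add
    ((hg.continuous.integrable_of_hasCompactSupport hc).const_mul _)

theorem integral_fderiv_apply_sub_add_finrank_mul (hg : ContDiff ℝ 1 g)
    (hc : HasCompactSupport g) (p : V) :
    ∫ x, (fderiv ℝ g x (x - p) + Module.finrank ℝ V * g x) = 0 := by
  let b := stdOrthonormalBasis ℝ V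
  have hg_int : Integrable g := hg.continuous.integrable_of_hasCompactSupport hc
  have hcoord : ∀ i x, HasFDerivAt (fun x => ⟪b i, x - p⟫_ℝ) (innerSL ℝ (b i)) x := fun i x =>
    (innerSL ℝ (b i)).hasFDerivAt.comp x ((hasFDerivAt_id x).sub_const p)
  have hint : ∀ i, Integrable fun x => ⟪b i, x - p⟫_ℝ * fderiv ℝ g x (b i) := fun i =>
    Continuous.integrable_of_hasCompactSupport
      ((by fun_prop : Continuous fun x => ⟪b i, x - p⟫_ℝ).mul
        ((hg.continuous_fderiv one_ne_zero).clm_apply continuous_const))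
      (hc.fderiv_apply ℝ (b i)).mul_left
  have hparts : ∀ i, ∫ x, ⟪b i, x - p⟫_ℝ * fderiv ℝ g x (b i) = -∫ x, g x := by
    intro i
    have hone : ∀ x, fderiv ℝ (fun x => ⟪b i, x - p⟫_ℝ) x (b i) = 1 := fun x => by
      rw [(hcoord i x).fderiv, innerSL_apply_apply, real_inner_self_eq_norm_sq, b.norm_eq_one,
        one_pow]
    rw [integral_mul_fderiv_eq_neg_fderiv_mul_of_integrable (by simpa only [hone, one_mul])
      (hint i) ?_ (fun x _ => (hcoord i x).differentiableAt)
      (fun x _ => hg.differentiable one_ne_zero x)]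
    · simp only [hone, one_mul]
    · exact Continuous.integrable_of_hasCompactSupport
        ((by fun_prop : Continuous fun x => ⟪b i, x - p⟫_ℝ).mul hg.continuous) hc.mul_left
  have hsum : ∀ x, fderiv ℝ g x (x - p) = ∑ i, ⟪b i, x - p⟫_ℝ * fderiv ℝ g x (b i) := fun x => by
    conv_lhs => rw [← b.sum_repr' (x - p)]
    simp only [map_sum, map_smul, smul_eq_mul]
  simp only [hsum]
  rw [integral_add (integrable_finsetSum _ fun i _ => hint i) (hg_int.const_mul _),
    integral_finsetSum _ fun i _ => hint i, integral_const_mul]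
  simp [hparts]

theorem integrable_norm_fderiv_sq (hφ : ContDiff ℝ 1 φ) (hc : HasCompactSupport φ) :
    Integrable fun x => ‖fderiv ℝ φ x‖ ^ 2 := by
  refine Continuous.integrable_of_hasCompactSupport
    ((hφ.continuous_fderiv one_ne_zero).norm.pow 2) ?_
  exact (hc.fderiv ℝ).comp_left (g := fun L => ‖L‖ ^ 2) (by simp)

-- Expand `0 ≤ ‖∇φ + φ a (x - p)‖²` and integrate the cross term by parts.
theorem integral_sq_mul_le_integral_norm_fderiv_sq (hφ : ContDiff ℝ 1 φ)
    (hc : HasCompactSupport φ) {a : ℝ → ℝ} {W : V → ℝ}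
    (ha : ∀ x ∈ tsupport φ, ContDiffAt ℝ 1 a (‖x - p‖ ^ 2))
    (hW₀ : ∀ x ∈ tsupport φ, 0 ≤ W x)
    (hW : ∀ x ∈ tsupport φ, W x ≤ 2 * ‖x - p‖ ^ 2 * deriv a (‖x - p‖ ^ 2) +
      Module.finrank ℝ V * a (‖x - p‖ ^ 2) - ‖x - p‖ ^ 2 * a (‖x - p‖ ^ 2) ^ 2) :
    ∫ x, φ x ^ 2 * W x ≤ ∫ x, ‖fderiv ℝ φ x‖ ^ 2 := by
  let g : V → ℝ := fun x => φ x ^ 2 * a (‖x - p‖ ^ 2)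
  have hsupp : tsupport g ⊆ tsupport φ := closure_mono fun x hx h => hx (by simp [g, h])
  have hg : ContDiff ℝ 1 g := by
    refine ContMDiff.contDiff (contMDiff_of_tsupport fun x hx => ContDiffAt.contMDiffAt ?_)
    exact (hφ.contDiffAt.pow 2).mul ((ha x (hsupp hx)).comp x
      ((contDiff_id.sub contDiff_const).norm_sq ℝ).contDiffAt)
  have hgc : HasCompactSupport g := hc.mono' (subset_closure.trans hsupp)
  have hpointwise : ∀ x, φ x ^ 2 * W x ≤ ‖fderiv ℝ φ x‖ ^ 2 +
      (fderiv ℝ g x (x - p) + Module.finrank ℝ V * g x) := by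
    intro x
    by_cases hx : x ∈ tsupport φ
    · have hderiv := fderiv_sq_mul_comp_norm_sub_sq_apply (hφ.differentiable one_ne_zero x)
        ((ha x hx).differentiableAt one_ne_zero)
      have hcross := neg_two_mul_mul_apply_le (fderiv ℝ φ x) (φ x * a (‖x - p‖ ^ 2)) (x - p)
      have hmul := mul_le_mul_of_nonneg_left (hW x hx) (sq_nonneg (φ x))
      rw [show fderiv ℝ g x (x - p) = _ from hderiv]
      simp only [g]
      linarith
    · have hgx : x ∉ tsupport g := fun h => hx (hsupp h)
      have hfderiv : fderiv ℝ g x = 0 :=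
        image_eq_zero_of_notMem_tsupport fun h => hgx (tsupport_fderiv_subset ℝ h)
      simp [image_eq_zero_of_notMem_tsupport hx, image_eq_zero_of_notMem_tsupport hgx, hfderiv]
  have hnonneg : ∀ x, 0 ≤ φ x ^ 2 * W x := fun x => by
    by_cases hx : x ∈ tsupport φ
    · exact mul_nonneg (sq_nonneg _) (hW₀ x hx)
    · simp [image_eq_zero_of_notMem_tsupport hx]
  have hφ_int := integrable_norm_fderiv_sq hφ hc
  have hg_int := integrable_fderiv_apply_sub_add_finrank_mul hg hgc p
  calc ∫ x, φ x ^ 2 * W x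
      ≤ ∫ x, (‖fderiv ℝ φ x‖ ^ 2 + (fderiv ℝ g x (x - p) + Module.finrank ℝ V * g x)) :=
        integral_mono_of_nonneg (Eventually.of_forall hnonneg) (hφ_int.add hg_int)
          (Eventually.of_forall hpointwise)
    _ = ∫ x, ‖fderiv ℝ φ x‖ ^ 2 := by
        rw [integral_add hφ_int hg_int, integral_fderiv_apply_sub_add_finrank_mul hg hgc p,
          add_zero]

theorem integral_sq_le_mul_integral_norm_fderiv_sq [Nontrivial V] {R : ℝ} (hR : 0 < R)
    (hφ : ContDiff ℝ 1 φ) (hc : HasCompactSupport φ) (hsupp : tsupport φ ⊆ Metric.ball p R) :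
    ∫ x, φ x ^ 2 ≤ (2 * R) ^ 2 * ∫ x, ‖fderiv ℝ φ x‖ ^ 2 := by
  have hhardy := integral_sq_mul_le_integral_norm_fderiv_sq (p := p) hφ hc
    (a := fun _ => (2 * R ^ 2)⁻¹) (W := fun _ => ((2 * R) ^ 2)⁻¹) (fun _ _ => contDiffAt_const)
    (fun _ _ => by positivity) fun x hx => ?_
  · rw [integral_mul_const, mul_inv_le_iff₀ (by positivity)] at hhardy
    linarith
  · have hxR : ‖x - p‖ ^ 2 ≤ R ^ 2 :=
      pow_le_pow_left₀ (norm_nonneg _) (mem_ball_iff_norm.mp (hsupp hx)).le 2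
    have hdim : (1 : ℝ) ≤ Module.finrank ℝ V := mod_cast Module.finrank_pos
    have hdim_mul := mul_le_mul_of_nonneg_right hdim (by positivity : 0 ≤ (2 * R ^ 2)⁻¹)
    have hxR_mul := mul_le_mul_of_nonneg_right hxR (by positivity : 0 ≤ (2 * R ^ 2)⁻¹ ^ 2)
    have hconst : ((2 * R) ^ 2)⁻¹ = 1 * (2 * R ^ 2)⁻¹ - R ^ 2 * (2 * R ^ 2)⁻¹ ^ 2 := by
      field_simp
      norm_num
    rw [deriv_const, hconst]
    linarith

end RadialHardy

section LogCutoff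

/-- The logarithmic distance `log (M / (s + ε))` as a function of a squared distance `s`; the
parameter `ε > 0` removes the singularity at `s = 0`. -/
def logDist (M ε s : ℝ) : ℝ := Real.log M - Real.log (s + ε)

/-- The radial profile of the vector field `x / (|x|² log (M / |x|²))`, regularised by `ε`, which
gives the critical Hardy inequality. -/
def logProfile (M ε s : ℝ) : ℝ := ((s + ε) * logDist M ε s)⁻¹

variable {M ε s : ℝ}

theorem logDist_pos (hs : 0 < s + ε) (hM : s + ε < M) : 0 < logDist M ε s :=
  sub_pos.mpr (Real.log_lt_log hs hM)

theorem contDiffAt_logDist {n : WithTop ℕ∞} (hs : s + ε ≠ 0) : ContDiffAt ℝ n (logDist M ε) s :=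
  contDiffAt_const.sub ((contDiffAt_id.add contDiffAt_const).log hs)

theorem hasDerivAt_logDist (hs : s + ε ≠ 0) : HasDerivAt (logDist M ε) (-(s + ε)⁻¹) s := by
  simpa using! (((hasDerivAt_id s).add_const ε).log hs).const_sub (Real.log M)

theorem contDiffAt_logProfile {n : WithTop ℕ∞} (hs : s + ε ≠ 0) (hL : logDist M ε s ≠ 0) :
    ContDiffAt ℝ n (logProfile M ε) s :=
  ((contDiffAt_id.add contDiffAt_const).mul (contDiffAt_logDist hs)).inv (mul_ne_zero hs hL)

theorem hasDerivAt_logProfile (hs : s + ε ≠ 0) (hL : logDist M ε s ≠ 0) :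
    HasDerivAt (logProfile M ε) (-(logDist M ε s - 1) * logProfile M ε s ^ 2) s := by
  convert! (((hasDerivAt_id s).add_const ε).mul (hasDerivAt_logDist hs)).inv (mul_ne_zero hs hL)
    using 1
  simp only [logProfile, id, Pi.mul_apply]
  field_simp
  ring

/-- The logarithmic cutoff as a function of a squared distance `s`: it is `0` where `logDist` is at
most `K` and `1` where `logDist` is at least `2 * K`. -/
def logCutoff (M ε K s : ℝ) : ℝ := Real.smoothTransition (logDist M ε s / K - 1)

theorem contDiffAt_logCutoff {n : ℕ∞} (hs : s + ε ≠ 0) (K : ℝ) :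
    ContDiffAt ℝ n (logCutoff M ε K) s :=
  Real.smoothTransition.contDiff.contDiffAt.comp s
    (((contDiffAt_logDist hs).div_const K).sub contDiffAt_const)

theorem logCutoff_eq_zero {K : ℝ} (hK : 0 < K) (h : logDist M ε s ≤ K) :
    logCutoff M ε K s = 0 :=
  Real.smoothTransition.zero_of_nonpos (sub_nonpos.mpr ((div_le_one hK).mpr h))

theorem logCutoff_eq_one {K : ℝ} (hK : 0 < K) (h : 2 * K ≤ logDist M ε s) :
    logCutoff M ε K s = 1 :=
  Real.smoothTransition.one_of_one_le (by linarith [(le_div_iff₀ hK).mpr h])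

theorem exists_abs_deriv_smoothTransition_mul_le :
    ∃ D > 0, ∀ y, |deriv Real.smoothTransition y * (y + 1)| ≤ D := by
  have hsmooth : ContDiff ℝ 1 Real.smoothTransition := Real.smoothTransition.contDiff
  have hcont : Continuous fun y => deriv Real.smoothTransition y * (y + 1) :=
    (hsmooth.continuous_deriv le_rfl).mul (by fun_prop)
  have hsupp : HasCompactSupport fun y => deriv Real.smoothTransition y * (y + 1) := by
    refine HasCompactSupport.intro (isCompact_Icc (a := 0) (b := 1)) fun y hy => ?_
    rw [Set.mem_Icc, not_and_or, not_le, not_le] at hy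
    have hconst : deriv Real.smoothTransition y = 0 := by
      rcases hy with hy | hy
      · refine ((hasDerivAt_const y (0 : ℝ)).congr_of_eventuallyEq ?_).deriv
        filter_upwards [Iio_mem_nhds hy] with z hz
        exact Real.smoothTransition.zero_of_nonpos hz.le
      · refine ((hasDerivAt_const y (1 : ℝ)).congr_of_eventuallyEq ?_).deriv
        filter_upwards [Ioi_mem_nhds hy] with z hz
        exact Real.smoothTransition.one_of_one_le hz.le
    rw [hconst, zero_mul]
  obtain ⟨D, hD⟩ := hsupp.exists_bound_of_continuous hcont
  exact ⟨max D 1, by positivity, fun y => (hD y).trans (le_max_left _ _)⟩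

theorem abs_deriv_logCutoff_le {K D : ℝ}
    (hD : ∀ y, |deriv Real.smoothTransition y * (y + 1)| ≤ D) (hs : 0 < s + ε) (hM : s + ε < M)
    (hK : 0 < K) : |deriv (logCutoff M ε K) s| ≤ D * logProfile M ε s := by
  have hL := logDist_pos hs hM
  have hderiv : HasDerivAt (logCutoff M ε K) (deriv Real.smoothTransition (logDist M ε s / K - 1) *
      (-(s + ε)⁻¹ / K)) s :=
    ((Real.smoothTransition.contDiff (n := 1)).differentiable one_ne_zero _).hasDerivAt.comp s
      (((hasDerivAt_logDist hs.ne').div_const K).sub_const 1)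
  have hprofile :
      |deriv Real.smoothTransition (logDist M ε s / K - 1)| * (logDist M ε s / K) ≤ D := by
    have h := hD (logDist M ε s / K - 1)
    rwa [sub_add_cancel, abs_mul, abs_of_pos (div_pos hL hK)] at h
  calc |deriv (logCutoff M ε K) s|
      = |deriv Real.smoothTransition (logDist M ε s / K - 1)| * (logDist M ε s / K) *
          logProfile M ε s := by
        rw [hderiv.deriv, abs_mul, abs_div, abs_neg, abs_inv, abs_of_pos hs, abs_of_pos hK,
          logProfile]
        field_simp
    _ ≤ D * logProfile M ε s := by
        gcongr
        exact inv_nonneg.mpr (mul_pos hs hL).le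

variable {V : Type*} [NormedAddCommGroup V] [InnerProductSpace ℝ V] {p : V}

theorem integral_sq_mul_le_of_le_logProfile [FiniteDimensional ℝ V] [MeasurableSpace V]
    [BorelSpace V] (hdim : 2 ≤ Module.finrank ℝ V) {φ W : V → ℝ} (hφ : ContDiff ℝ 1 φ)
    (hc : HasCompactSupport φ) (hε : 0 < ε) (hM : ∀ x ∈ tsupport φ, ‖x - p‖ ^ 2 + ε < M)
    (hW₀ : ∀ x, 0 ≤ W x)
    (hW : ∀ x ∈ tsupport φ, W x ≤ ‖x - p‖ ^ 2 * logProfile M ε (‖x - p‖ ^ 2) ^ 2) :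
    ∫ x, φ x ^ 2 * W x ≤ ∫ x, ‖fderiv ℝ φ x‖ ^ 2 := by
  have hpos : ∀ x, 0 < ‖x - p‖ ^ 2 + ε := fun x => by positivity
  have hL : ∀ x ∈ tsupport φ, 0 < logDist M ε (‖x - p‖ ^ 2) := fun x hx =>
    logDist_pos (hpos x) (hM x hx)
  refine integral_sq_mul_le_integral_norm_fderiv_sq (p := p) hφ hc (a := logProfile M ε)
    (fun x hx => contDiffAt_logProfile (hpos x).ne' (hL x hx).ne') (fun x _ => hW₀ x)
    fun x hx => (hW x hx).trans ?_
  rw [(hasDerivAt_logProfile (hpos x).ne' (hL x hx).ne').deriv]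
  specialize hpos x
  specialize hL x hx
  set s := ‖x - p‖ ^ 2
  set L := logDist M ε s
  set a := logProfile M ε s with ha
  have ha₀ : 0 ≤ a := by rw [ha, logProfile]; positivity
  have hsLa : s * L * a ≤ 1 := by
    rw [ha, logProfile, ← div_eq_mul_inv, div_le_one (by positivity)]
    gcongr
    linarith
  have hdim_mul := mul_le_mul_of_nonneg_right (Nat.ofNat_le_cast.mpr hdim : (2 : ℝ) ≤ _) ha₀
  have hsLa_mul := mul_le_mul_of_nonneg_left hsLa ha₀
  nlinarith

theorem contDiff_logCutoff_norm_sub_sq (hε : 0 < ε) (K : ℝ) :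
    ContDiff ℝ ∞ fun x : V => logCutoff M ε K (‖x - p‖ ^ 2) :=
  contDiff_iff_contDiffAt.mpr fun x => ContDiffAt.comp (g := logCutoff M ε K) x
    (contDiffAt_logCutoff (by positivity) K) ((contDiff_id.sub contDiff_const).norm_sq ℝ).contDiffAt

theorem norm_fderiv_logCutoff_norm_sub_sq_sq_le {K D : ℝ}
    (hD : ∀ y, |deriv Real.smoothTransition y * (y + 1)| ≤ D) (hε : 0 < ε) {x : V}
    (hM : ‖x - p‖ ^ 2 + ε < M) (hK : 0 < K) :
    ‖fderiv ℝ (fun x => logCutoff M ε K (‖x - p‖ ^ 2)) x‖ ^ 2 ≤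
      (2 * D) ^ 2 * (‖x - p‖ ^ 2 * logProfile M ε (‖x - p‖ ^ 2) ^ 2) := by
  have hpos : 0 < ‖x - p‖ ^ 2 + ε := by positivity
  have hderiv : HasDerivAt (logCutoff M ε K) (deriv (logCutoff M ε K) (‖x - p‖ ^ 2))
      (‖x - p‖ ^ 2) :=
    ((contDiffAt_logCutoff (n := 1) hpos.ne' K).differentiableAt one_ne_zero).hasDerivAt
  have hfderiv := (hderiv.comp_hasFDerivAt x (hasFDerivAt_norm_sub_sq p x)).fderiv
  rw [Function.comp_def] at hfderiv
  have hbound : ‖fderiv ℝ (fun x => logCutoff M ε K (‖x - p‖ ^ 2)) x‖ ≤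
      2 * D * (‖x - p‖ * logProfile M ε (‖x - p‖ ^ 2)) := by
    rw [hfderiv, norm_smul, ← Nat.cast_smul_eq_nsmul ℝ, norm_smul, innerSL_apply_norm,
      Real.norm_eq_abs, Nat.cast_ofNat, Real.norm_ofNat]
    calc |deriv (logCutoff M ε K) (‖x - p‖ ^ 2)| * (2 * ‖x - p‖)
        ≤ D * logProfile M ε (‖x - p‖ ^ 2) * (2 * ‖x - p‖) := by
          gcongr
          exact abs_deriv_logCutoff_le hD hpos hM hK
      _ = 2 * D * (‖x - p‖ * logProfile M ε (‖x - p‖ ^ 2)) := by ring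
  calc _ ≤ (2 * D * (‖x - p‖ * logProfile M ε (‖x - p‖ ^ 2))) ^ 2 := by gcongr
    _ = _ := by ring

theorem exists_logCutoff [FiniteDimensional ℝ V] [MeasurableSpace V] [BorelSpace V]
    (hdim : 2 ≤ Module.finrank ℝ V) (p : V) (R : ℝ) :
    ∃ C > 0, ∀ τ > 0, ∃ r > 0, ∃ σ : V → ℝ, ContDiff ℝ ∞ σ ∧ (∀ x, σ x ∈ Set.Icc 0 1) ∧
      (∀ x ∈ Metric.ball p r, σ x = 1) ∧ (∀ x ∉ Metric.ball p τ, σ x = 0) ∧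
      ∀ φ : V → ℝ, ContDiff ℝ 1 φ → HasCompactSupport φ → tsupport φ ⊆ Metric.ball p R →
        ∫ x, φ x ^ 2 * ‖fderiv ℝ σ x‖ ^ 2 ≤ C * ∫ x, ‖fderiv ℝ φ x‖ ^ 2 := by
  obtain ⟨D, hD₀, hD⟩ := exists_abs_deriv_smoothTransition_mul_le
  refine ⟨(2 * D) ^ 2, by positivity, fun τ hτ => ?_⟩
  -- `K` bounds `logDist` outside the ball of radius `τ`, and `ε` is so small that `logDist` is at
  -- least `2 * K` on the ball of radius `√ε`.
  set M : ℝ := R ^ 2 + 1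
  have hM₀ : 0 < M := by positivity
  set K : ℝ := |Real.log M - Real.log (τ ^ 2)| + 1
  have hK₀ : 0 < K := by positivity
  set ε : ℝ := min 1 (M * Real.exp (-(2 * K))) / 2 with hε
  have hε₀ : 0 < ε := by positivity
  refine ⟨√ε, Real.sqrt_pos.mpr hε₀, fun x => logCutoff M ε K (‖x - p‖ ^ 2),
    contDiff_logCutoff_norm_sub_sq hε₀ K,
    fun x => ⟨Real.smoothTransition.nonneg _, Real.smoothTransition.le_one _⟩,
    fun x hx => ?_, fun x hx => ?_, fun φ hφ hc hsupp => ?_⟩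
  · have hx' : ‖x - p‖ ^ 2 + ε ≤ M * Real.exp (-(2 * K)) := by
      have := Real.lt_sqrt (norm_nonneg _) |>.mp (mem_ball_iff_norm.mp hx)
      linarith [min_le_right 1 (M * Real.exp (-(2 * K)))]
    have hlog := Real.log_le_log (by positivity) hx'
    rw [Real.log_mul hM₀.ne' (Real.exp_ne_zero _), Real.log_exp] at hlog
    exact logCutoff_eq_one hK₀ (by rw [logDist]; linarith)
  · have hx' : τ ^ 2 ≤ ‖x - p‖ ^ 2 + ε := by
      rw [mem_ball_iff_norm, not_lt] at hx
      nlinarith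
    have hlog := Real.log_le_log (by positivity) hx'
    exact logCutoff_eq_zero hK₀ (by
      rw [logDist]; linarith [le_abs_self (Real.log M - Real.log (τ ^ 2))])
  · have hM : ∀ x ∈ tsupport φ, ‖x - p‖ ^ 2 + ε < M := fun x hx => by
      have hx' := mem_ball_iff_norm.mp (hsupp hx)
      have hsq : ‖x - p‖ ^ 2 ≤ R ^ 2 := by gcongr
      linarith [min_le_left 1 (M * Real.exp (-(2 * K)))]
    have hhardy := integral_sq_mul_le_of_le_logProfile hdim hφ hc hε₀ hM
      (W := fun x => ((2 * D) ^ 2)⁻¹ * ‖fderiv ℝ (fun x => logCutoff M ε K (‖x - p‖ ^ 2)) x‖ ^ 2)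
      (fun x => by positivity) fun x hx => (inv_mul_le_iff₀ (by positivity)).mpr
        (norm_fderiv_logCutoff_norm_sub_sq_sq_le hD hε₀ (hM x hx) hK₀)
    rw [← inv_mul_le_iff₀ (by positivity), ← integral_const_mul]
    simpa only [mul_left_comm] using hhardy

end LogCutoff

section Sobolev

variable {d : ℕ} {Ω Ω' : Set (E d)} {φ σ : E d → ℝ} {u v : H1 d} {f : L2 d}

theorem norm_gradient {V : Type*} [NormedAddCommGroup V] [InnerProductSpace ℝ V] [CompleteSpace V]
    (φ : V → ℝ) (x : V) : ‖gradient φ x‖ = ‖fderiv ℝ φ x‖ :=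
  LinearIsometryEquiv.norm_map _ _

theorem IsTestFunction.mono (h : IsTestFunction Ω φ) (hΩ : Ω ⊆ Ω') : IsTestFunction Ω' φ :=
  ⟨h.1, h.2.1, h.2.2.trans hΩ⟩

theorem IsTestFunction.mul (h : IsTestFunction Ω φ) (hσ : ContDiff ℝ ∞ σ) :
    IsTestFunction (Ω ∩ tsupport σ) fun x => φ x * σ x :=
  ⟨h.1.mul hσ, h.2.1.mul_right, Set.subset_inter ((tsupport_mul_subset_left ..).trans h.2.2)
    (tsupport_mul_subset_right ..)⟩

theorem IsTestFunction.contDiff_one (h : IsTestFunction Ω φ) : ContDiff ℝ 1 φ :=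
  h.1.of_le (by simp)

theorem IsTestFunction.memLp_gradient (h : IsTestFunction Ω φ) : MemLp (gradient φ) 2 volume :=
  ((LinearIsometryEquiv.continuous _).comp
    (h.contDiff_one.continuous_fderiv one_ne_zero)).memLp_of_hasCompactSupport
    ((h.2.1.fderiv ℝ).comp_left (map_zero _))

theorem IsTestFunction.isWeakGradient (h : IsTestFunction Ω φ) :
    IsWeakGradient (h.memLp.toLp φ) (h.memLp_gradient.toLp (gradient φ)) := by
  intro ψ hψ v
  have hfn : ∫ x, h.memLp.toLp φ x * fderiv ℝ ψ x v = ∫ x, φ x * fderiv ℝ ψ x v :=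
    integral_congr_ae (h.memLp.coeFn_toLp.mono fun x hx => by simp only [hx])
  have hgrad : ∫ x, ⟪h.memLp_gradient.toLp (gradient φ) x, v⟫_ℝ * ψ x =
      ∫ x, fderiv ℝ φ x v * ψ x :=
    integral_congr_ae (h.memLp_gradient.coeFn_toLp.mono fun x hx => by
      simp only [hx, inner_gradient_left])
  rw [hfn, hgrad]
  exact integral_mul_fderiv_eq_neg_fderiv_mul_of_integrable
    ((h.memLp_fderiv v).integrable_mul hψ.memLp) (h.memLp.integrable_mul (hψ.memLp_fderiv v))
    (h.memLp.integrable_mul hψ.memLp) (fun x _ => h.1.differentiable (by simp) x)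
    (fun x _ => hψ.1.differentiable (by simp) x)

/-- A test function as an element of `H¹(ℝ^d)`. -/
def IsTestFunction.toH1 (h : IsTestFunction Ω φ) : H1 d :=
  ⟨WithLp.toLp 2 (h.memLp.toLp φ, h.memLp_gradient.toLp (gradient φ)), h.isWeakGradient⟩

theorem IsTestFunction.fn_toH1 (h : IsTestFunction Ω φ) : fn h.toH1 =ᵐ[volume] φ :=
  h.memLp.coeFn_toLp

theorem IsTestFunction.grad_toH1 (h : IsTestFunction Ω φ) :
    grad h.toH1 =ᵐ[volume] gradient φ :=
  h.memLp_gradient.coeFn_toLp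

theorem IsTestFunction.toH1_mem (h : IsTestFunction Ω φ) : h.toH1 ∈ testSpace Ω :=
  ⟨φ, h, h.fn_toH1, h.grad_toH1⟩

theorem H1.ext (hfn : fn u = fn v) (hgrad : grad u = grad v) : u = v :=
  Subtype.ext (WithLp.ofLp_injective 2 (Prod.ext hfn hgrad))

theorem IsTestFunction.toH1_eq_add {φ₁ φ₂ : E d → ℝ} {Ω₁ Ω₂ : Set (E d)}
    (h : IsTestFunction Ω φ) (h₁ : IsTestFunction Ω₁ φ₁) (h₂ : IsTestFunction Ω₂ φ₂)
    (heq : φ = φ₁ + φ₂) : h.toH1 = h₁.toH1 + h₂.toH1 := by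
  subst heq
  have hgradient : gradient (φ₁ + φ₂) = gradient φ₁ + gradient φ₂ := funext fun x => by
    simp only [gradient, Pi.add_apply, ← map_add]
    rw [fderiv_add (h₁.1.differentiable (by simp) x) (h₂.1.differentiable (by simp) x)]
  refine H1.ext (h₁.memLp.toLp_add h₂.memLp) (Eq.trans ?_
    (h₁.memLp_gradient.toLp_add h₂.memLp_gradient))
  exact MemLp.toLp_congr h.memLp_gradient (h₁.memLp_gradient.add h₂.memLp_gradient)
    (.of_forall (congrFun hgradient))

theorem mem_testSpace_iff :
    u ∈ testSpace Ω ↔ ∃ (φ : E d → ℝ) (h : IsTestFunction Ω φ), h.toH1 = u := by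
  constructor
  · rintro ⟨φ, h, hfn, hgrad⟩
    exact ⟨φ, h, H1.ext (Lp.ext (h.fn_toH1.trans hfn.symm)) (Lp.ext (h.grad_toH1.trans hgrad.symm))⟩
  · rintro ⟨φ, h, rfl⟩
    exact h.toH1_mem

/-- The weak gradient as a continuous linear map. -/
def gradL (d : ℕ) : H1 d →L[ℝ] L2Vec d := (WithLp.sndL 2 ℝ (L2 d) (L2Vec d)).comp (H1 d).subtypeL

/-- The underlying `L²` function as a continuous linear map. -/
def fnL (d : ℕ) : H1 d →L[ℝ] L2 d := (WithLp.fstL 2 ℝ (L2 d) (L2Vec d)).comp (H1 d).subtypeL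

theorem inner_eq_add (u v : H1 d) : ⟪u, v⟫_ℝ = ⟪fn u, fn v⟫_ℝ + ⟪grad u, grad v⟫_ℝ :=
  WithLp.prod_inner_apply _ _

theorem norm_sq_eq_add (u : H1 d) : ‖u‖ ^ 2 = ‖fn u‖ ^ 2 + ‖grad u‖ ^ 2 :=
  WithLp.prod_norm_sq_eq_of_L2 (u : WithLp 2 (L2 d × L2Vec d))

theorem norm_sq_toLp {α F : Type*} {m : MeasurableSpace α} {μ : Measure α} [NormedAddCommGroup F]
    [InnerProductSpace ℝ F] {g : α → F} (hg : MemLp g 2 μ) :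
    ‖hg.toLp g‖ ^ 2 = ∫ x, ‖g x‖ ^ 2 ∂μ := by
  rw [← real_inner_self_eq_norm_sq, L2.inner_def]
  refine integral_congr_ae (hg.coeFn_toLp.mono fun x hx => ?_)
  simp only [hx, real_inner_self_eq_norm_sq]

theorem IsTestFunction.norm_sq_fn_toH1 (h : IsTestFunction Ω φ) :
    ‖fn h.toH1‖ ^ 2 = ∫ x, φ x ^ 2 :=
  (norm_sq_toLp h.memLp).trans (by simp only [Real.norm_eq_abs, sq_abs])

theorem IsTestFunction.norm_sq_grad_toH1 (h : IsTestFunction Ω φ) :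
    ‖grad h.toH1‖ ^ 2 = ∫ x, ‖fderiv ℝ φ x‖ ^ 2 :=
  (norm_sq_toLp h.memLp_gradient).trans (by simp only [norm_gradient])

theorem continuous_integral_fst_mul_fderiv (h : IsTestFunction Ω φ) (v : E d) :
    Continuous fun w : WithLp 2 (L2 d × L2Vec d) => ∫ x, w.fst x * fderiv ℝ φ x v := by
  have heq : ∀ w : WithLp 2 (L2 d × L2Vec d),
      ∫ x, w.fst x * fderiv ℝ φ x v = ⟪(h.memLp_fderiv v).toLp _, w.fst⟫_ℝ := fun w => by
    rw [L2.inner_def]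
    refine integral_congr_ae ((h.memLp_fderiv v).coeFn_toLp.mono fun x hx => ?_)
    simp only [hx, RCLike.inner_apply, conj_trivial]
  simp only [heq]
  fun_prop

theorem continuous_integral_inner_snd_mul (h : IsTestFunction Ω φ) (v : E d) :
    Continuous fun w : WithLp 2 (L2 d × L2Vec d) => ∫ x, ⟪w.snd x, v⟫_ℝ * φ x := by
  have hv : MemLp (fun x => φ x • v) 2 volume :=
    (h.1.continuous.smul continuous_const).memLp_of_hasCompactSupport
      (h.2.1.smul_right (f' := fun _ => v))
  have heq : ∀ w : WithLp 2 (L2 d × L2Vec d),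
      ∫ x, ⟪w.snd x, v⟫_ℝ * φ x = ⟪w.snd, hv.toLp _⟫_ℝ := fun w => by
    rw [L2.inner_def]
    refine integral_congr_ae (hv.coeFn_toLp.mono fun x hx => ?_)
    simp only [hx, real_inner_smul_right, mul_comm]
  simp only [heq]
  fun_prop

theorem isClosed_H1 (d : ℕ) : IsClosed (H1 d : Set (WithLp 2 (L2 d × L2Vec d))) := by
  have hset : (H1 d : Set (WithLp 2 (L2 d × L2Vec d))) =
      ⋂ (φ : E d → ℝ) (_ : IsTestFunction Set.univ φ) (v : E d),
        {w | ∫ x, w.fst x * fderiv ℝ φ x v = -∫ x, ⟪w.snd x, v⟫_ℝ * φ x} := by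
    ext w
    simp only [Set.mem_iInter, Set.mem_ofPred_eq]
    rfl
  rw [hset]
  exact isClosed_iInter fun φ => isClosed_iInter fun hφ => isClosed_iInter fun v =>
    isClosed_eq (continuous_integral_fst_mul_fderiv hφ v)
      (continuous_integral_inner_snd_mul hφ v).neg

instance : CompleteSpace (H1 d) := (isClosed_H1 d).completeSpace_coe

theorem isClosed_H10 (Ω : Set (E d)) : IsClosed (H10 Ω : Set (H1 d)) :=
  (testSpace Ω).isClosed_topologicalClosure

theorem IsTestFunction.toH1_mem_H10 (h : IsTestFunction Ω φ) : h.toH1 ∈ H10 Ω :=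
  (testSpace Ω).le_topologicalClosure h.toH1_mem

theorem H10_induction {P : H1 d → Prop} (hP : IsClosed {u | P u})
    (htest : ∀ φ, ∀ h : IsTestFunction Ω φ, P h.toH1) : ∀ u ∈ H10 Ω, P u := fun _ hu =>
  closure_minimal (s := (testSpace Ω : Set (H1 d))) (fun _ hw => by
    obtain ⟨φ, h, rfl⟩ := mem_testSpace_iff.mp hw
    exact htest φ h) hP hu

theorem H10_mono (h : Ω ⊆ Ω') : H10 Ω ≤ H10 Ω' :=
  H10_induction (isClosed_H10 Ω') fun _ hφ => (hφ.mono h).toH1_mem_H10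

theorem H10_iUnion_le_topologicalClosure_iSup {ι : Type*} [Nonempty ι] {Ω : ι → Set (E d)}
    (hΩ : ∀ i, IsOpen (Ω i)) (hdir : Directed (· ⊆ ·) Ω) :
    H10 (⋃ i, Ω i) ≤ (⨆ i, H10 (Ω i)).topologicalClosure := by
  refine H10_induction (Submodule.isClosed_topologicalClosure _) fun φ hφ => ?_
  obtain ⟨i, hi⟩ := hφ.2.1.isCompact.elim_directed_cover Ω hΩ hφ.2.2 hdir
  have hφi : IsTestFunction (Ω i) φ := ⟨hφ.1, hφ.2.1, hi⟩
  exact Submodule.le_topologicalClosure _ (le_iSup (fun i => H10 (Ω i)) i hφi.toH1_mem_H10)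

theorem norm_le_mul_norm_grad_of_mem_H10 [Nontrivial (E d)] {p : E d} {R : ℝ} (hR : 0 < R)
    (hΩ : Ω ⊆ Metric.ball p R) : ∀ u ∈ H10 Ω, ‖u‖ ≤ (2 * R + 1) * ‖gradL d u‖ := by
  refine H10_induction (isClosed_le (by fun_prop) (by fun_prop)) fun φ h => ?_
  refine le_of_sq_le_sq ?_ (by positivity)
  have hpoincare := integral_sq_le_mul_integral_norm_fderiv_sq hR h.contDiff_one h.2.1
    (h.2.2.trans hΩ)
  rw [← h.norm_sq_fn_toH1, ← h.norm_sq_grad_toH1] at hpoincare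
  calc ‖h.toH1‖ ^ 2 = ‖fn h.toH1‖ ^ 2 + ‖grad h.toH1‖ ^ 2 := norm_sq_eq_add _
    _ ≤ ((2 * R) ^ 2 + 1) * ‖grad h.toH1‖ ^ 2 := by linarith
    _ ≤ ((2 * R + 1) * ‖grad h.toH1‖) ^ 2 := by
      rw [mul_pow _ ‖_‖]
      gcongr
      nlinarith

theorem isSolution_iff_isGalerkinSolution :
    IsSolution Ω f u ↔ IsGalerkinSolution (gradL d) (H10 Ω) ((innerSL ℝ f).comp (fnL d)) u := by
  refine and_congr_right fun _ => forall₂_congr fun φ _ => ?_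
  have hgrad : ∫ x, ⟪grad u x, grad φ x⟫_ℝ = ⟪gradL d u, gradL d φ⟫_ℝ := (L2.inner_def _ _).symm
  have hfn : ∫ x, f x * fn φ x = (innerSL ℝ f).comp (fnL d) φ := by
    refine Eq.trans ?_ (L2.inner_def f (fn φ)).symm
    simp only [RCLike.inner_apply, conj_trivial, mul_comm]
  rw [hgrad, hfn]

theorem exists_isUniqueSolution [Nontrivial (E d)] (hΩ : Bornology.IsBounded Ω) (f : L2 d) :
    ∃ u, IsUniqueSolution Ω f u := by
  obtain ⟨R, hR, hΩR⟩ := hΩ.subset_ball_lt 0 0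
  have hpoincare := norm_le_mul_norm_grad_of_mem_H10 hR hΩR
  obtain ⟨u, hu⟩ := exists_isGalerkinSolution (isClosed_H10 Ω) (by positivity) hpoincare
    ((innerSL ℝ f).comp (fnL d))
  exact ⟨u, isSolution_iff_isGalerkinSolution.mpr hu, fun v hv =>
    (isSolution_iff_isGalerkinSolution.mp hv).unique hpoincare hu⟩

end Sobolev

section Removability

theorem exists_forall_abs_inner_le_of_ae_eq_zero {α F : Type*} {m : MeasurableSpace α}
    {μ : Measure α} [NormedAddCommGroup F] [InnerProductSpace ℝ F] (g : Lp F 2 μ) {ε : ℝ}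
    (hε : 0 < ε) :
    ∃ δ > 0, ∀ s, MeasurableSet s → μ s ≤ ENNReal.ofReal δ →
      ∀ f : Lp F 2 μ, (∀ᵐ x ∂μ, x ∉ s → f x = 0) → |⟪f, g⟫_ℝ| ≤ ε * ‖f‖ := by
  obtain ⟨δ, hδ, hg⟩ := (Lp.memLp g).eLpNorm_indicator_le one_le_two (by simp) hε
  refine ⟨δ, hδ, fun s hs hμs f hf => ?_⟩
  have hgs : MemLp (s.indicator g) 2 μ := (Lp.memLp g).indicator hs
  have hinner : ⟪f, g⟫_ℝ = ⟪f, hgs.toLp _⟫_ℝ := by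
    rw [L2.inner_def, L2.inner_def]
    refine integral_congr_ae ?_
    filter_upwards [hf, hgs.coeFn_toLp] with x hfx hgx
    by_cases hx : x ∈ s
    · rw [hgx, Set.indicator_of_mem hx]
    · rw [hfx hx, inner_zero_left, inner_zero_left]
  have hnorm : ‖hgs.toLp _‖ ≤ ε := by
    rw [Lp.norm_toLp]
    exact ENNReal.toReal_le_of_le_ofReal hε.le (hg s hs hμs)
  calc |⟪f, g⟫_ℝ| ≤ ‖f‖ * ‖hgs.toLp _‖ := hinner ▸ abs_real_inner_le_norm _ _
    _ ≤ ε * ‖f‖ := by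
      rw [mul_comm]
      gcongr

theorem exists_measure_closedBall_le {X : Type*} [MetricSpace X] [ProperSpace X]
    [MeasurableSpace X] [OpensMeasurableSpace X] (μ : Measure X) [IsFiniteMeasureOnCompacts μ]
    [NullSingletonClass μ] (p : X) {δ : ENNReal} (hδ : δ ≠ 0) :
    ∃ τ > 0, μ (Metric.closedBall p τ) ≤ δ := by
  have htendsto := tendsto_measure_cthickening_of_isCompact (μ := μ) (isCompact_singleton (x := p))
  rw [measure_singleton] at htendsto
  have hle : ∀ᶠ τ in 𝓝[>] (0 : ℝ), μ (Metric.cthickening τ {p}) ≤ δ :=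
    (htendsto.mono_left nhdsWithin_le_nhds).eventually_le_const hδ.bot_lt
  obtain ⟨τ, hμ, hτ⟩ := (hle.and self_mem_nhdsWithin).exists
  exact ⟨τ, hτ, Metric.cthickening_singleton p hτ.le ▸ hμ⟩

variable {d : ℕ} {Ω Ω' : Set (E d)} {φ σ : E d → ℝ}

theorem norm_fn_le (u : H1 d) : ‖fn u‖ ≤ ‖u‖ := by
  have := norm_sq_eq_add u
  exact le_of_sq_le_sq (by nlinarith [sq_nonneg ‖grad u‖]) (norm_nonneg _)

theorem norm_grad_le (u : H1 d) : ‖grad u‖ ≤ ‖u‖ := by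
  have := norm_sq_eq_add u
  exact le_of_sq_le_sq (by nlinarith [sq_nonneg ‖fn u‖]) (norm_nonneg _)

theorem exists_forall_abs_inner_toH1_le [Nontrivial (E d)] (v : H1 d) (p : E d) {ε : ℝ}
    (hε : 0 < ε) : ∃ τ > 0, ∀ φ, ∀ h : IsTestFunction (Metric.closedBall p τ) φ,
      |⟪h.toH1, v⟫_ℝ| ≤ ε * ‖h.toH1‖ := by
  obtain ⟨δ₁, hδ₁, hfn⟩ := exists_forall_abs_inner_le_of_ae_eq_zero (fn v) (half_pos hε)
  obtain ⟨δ₂, hδ₂, hgrad⟩ := exists_forall_abs_inner_le_of_ae_eq_zero (grad v) (half_pos hε)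
  obtain ⟨τ, hτ, hvol⟩ := exists_measure_closedBall_le volume p
    (ENNReal.ofReal_pos.mpr (lt_min hδ₁ hδ₂)).ne'
  refine ⟨τ, hτ, fun φ h => ?_⟩
  have hmeas : MeasurableSet (Metric.closedBall p τ) := Metric.isClosed_closedBall.measurableSet
  have hfn_zero : ∀ᵐ x, x ∉ Metric.closedBall p τ → fn h.toH1 x = 0 :=
    h.fn_toH1.mono fun x hx hxp => hx.trans (image_eq_zero_of_notMem_tsupport fun h' =>
      hxp (h.2.2 h'))
  have hgrad_zero : ∀ᵐ x, x ∉ Metric.closedBall p τ → grad h.toH1 x = 0 :=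
    h.grad_toH1.mono fun x hx hxp => by
      rw [hx, ← norm_eq_zero, norm_gradient, norm_eq_zero]
      exact image_eq_zero_of_notMem_tsupport fun h' => hxp (h.2.2 (tsupport_fderiv_subset ℝ h'))
  calc |⟪h.toH1, v⟫_ℝ| ≤ |⟪fn h.toH1, fn v⟫_ℝ| + |⟪grad h.toH1, grad v⟫_ℝ| :=
        inner_eq_add h.toH1 v ▸ abs_add_le _ _
    _ ≤ ε / 2 * ‖fn h.toH1‖ + ε / 2 * ‖grad h.toH1‖ :=
        add_le_add
          (hfn _ hmeas (hvol.trans (ENNReal.ofReal_le_ofReal (min_le_left _ _))) _ hfn_zero)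
          (hgrad _ hmeas (hvol.trans (ENNReal.ofReal_le_ofReal (min_le_right _ _))) _ hgrad_zero)
    _ ≤ ε / 2 * ‖h.toH1‖ + ε / 2 * ‖h.toH1‖ := by
        gcongr
        exacts [norm_fn_le _, norm_grad_le _]
    _ = ε * ‖h.toH1‖ := by ring

theorem norm_sq_fderiv_mul_le {x : E d} (hφ : DifferentiableAt ℝ φ x)
    (hσ : DifferentiableAt ℝ σ x) (hσ_mem : σ x ∈ Set.Icc 0 1) :
    ‖fderiv ℝ (fun x => φ x * σ x) x‖ ^ 2 ≤
      2 * ‖fderiv ℝ φ x‖ ^ 2 + 2 * (φ x ^ 2 * ‖fderiv ℝ σ x‖ ^ 2) := by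
  have hderiv := (hφ.hasFDerivAt.mul hσ.hasFDerivAt).fderiv
  have hnorm : ‖fderiv ℝ (fun x => φ x * σ x) x‖ ≤ |φ x| * ‖fderiv ℝ σ x‖ + ‖fderiv ℝ φ x‖ := by
    calc _ ≤ ‖φ x • fderiv ℝ σ x‖ + ‖σ x • fderiv ℝ φ x‖ := hderiv ▸ norm_add_le _ _
      _ ≤ |φ x| * ‖fderiv ℝ σ x‖ + 1 * ‖fderiv ℝ φ x‖ := by
        rw [norm_smul, norm_smul, Real.norm_eq_abs, Real.norm_of_nonneg hσ_mem.1]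
        gcongr
        exact hσ_mem.2
      _ = _ := by rw [one_mul]
  calc _ ≤ (|φ x| * ‖fderiv ℝ σ x‖ + ‖fderiv ℝ φ x‖) ^ 2 := by gcongr
    _ ≤ 2 * ((|φ x| * ‖fderiv ℝ σ x‖) ^ 2 + ‖fderiv ℝ φ x‖ ^ 2) := add_sq_le
    _ = _ := by rw [mul_pow, sq_abs]; ring

theorem IsTestFunction.integral_norm_sq_fderiv_mul_le (h : IsTestFunction Ω φ)
    (hσ : ContDiff ℝ ∞ σ) (hσ_mem : ∀ x, σ x ∈ Set.Icc 0 1) :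
    ∫ x, ‖fderiv ℝ (fun x => φ x * σ x) x‖ ^ 2 ≤
      2 * (∫ x, ‖fderiv ℝ φ x‖ ^ 2) + 2 * ∫ x, φ x ^ 2 * ‖fderiv ℝ σ x‖ ^ 2 := by
  have hcont : Continuous fun x => φ x ^ 2 * ‖fderiv ℝ σ x‖ ^ 2 :=
    (h.1.continuous.pow 2).mul ((hσ.continuous_fderiv (by simp)).norm.pow 2)
  have hint_mul : Integrable fun x => 2 * (φ x ^ 2 * ‖fderiv ℝ σ x‖ ^ 2) :=
    (hcont.integrable_of_hasCompactSupport
      (h.2.1.comp_left (g := (· ^ 2)) (by simp)).mul_right).const_mul 2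
  have hint_fderiv : Integrable fun x => 2 * ‖fderiv ℝ φ x‖ ^ 2 :=
    (integrable_norm_fderiv_sq h.contDiff_one h.2.1).const_mul 2
  calc _ ≤ ∫ x, (2 * ‖fderiv ℝ φ x‖ ^ 2 + 2 * (φ x ^ 2 * ‖fderiv ℝ σ x‖ ^ 2)) :=
        integral_mono (integrable_norm_fderiv_sq (h.mul hσ).contDiff_one (h.mul hσ).2.1)
          (hint_fderiv.add hint_mul) fun x =>
          norm_sq_fderiv_mul_le (h.1.differentiable (by simp) x)
            (hσ.differentiable (by simp) x) (hσ_mem x)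
    _ = _ := by rw [integral_add hint_fderiv hint_mul, integral_const_mul, integral_const_mul]

theorem IsTestFunction.norm_toH1_mul_le (h : IsTestFunction Ω φ) (hσ : ContDiff ℝ ∞ σ)
    (hσ_mem : ∀ x, σ x ∈ Set.Icc 0 1) {C : ℝ} (hC₀ : 0 ≤ C)
    (hC : ∫ x, φ x ^ 2 * ‖fderiv ℝ σ x‖ ^ 2 ≤ C * ∫ x, ‖fderiv ℝ φ x‖ ^ 2) :
    ‖(h.mul hσ).toH1‖ ≤ (2 * C + 2) * ‖h.toH1‖ := by
  have hfn : ‖fn (h.mul hσ).toH1‖ ^ 2 ≤ ‖fn h.toH1‖ ^ 2 := by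
    rw [(h.mul hσ).norm_sq_fn_toH1, h.norm_sq_fn_toH1]
    refine integral_mono (h.mul hσ).memLp.integrable_sq h.memLp.integrable_sq fun x => ?_
    simp only [mul_pow]
    exact mul_le_of_le_one_right (sq_nonneg _) (pow_le_one₀ (hσ_mem x).1 (hσ_mem x).2)
  have hgrad : ‖grad (h.mul hσ).toH1‖ ^ 2 ≤ (2 * C + 2) * ‖grad h.toH1‖ ^ 2 := by
    rw [(h.mul hσ).norm_sq_grad_toH1, h.norm_sq_grad_toH1]
    linarith [h.integral_norm_sq_fderiv_mul_le hσ hσ_mem]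
  refine le_of_sq_le_sq ?_ (by positivity)
  calc ‖(h.mul hσ).toH1‖ ^ 2 = ‖fn (h.mul hσ).toH1‖ ^ 2 + ‖grad (h.mul hσ).toH1‖ ^ 2 :=
        norm_sq_eq_add _
    _ ≤ (2 * C + 2) ^ 2 * ‖fn h.toH1‖ ^ 2 + (2 * C + 2) ^ 2 * ‖grad h.toH1‖ ^ 2 :=
        add_le_add (hfn.trans (le_mul_of_one_le_left (sq_nonneg _) (by nlinarith)))
          (hgrad.trans (mul_le_mul_of_nonneg_right (by nlinarith) (sq_nonneg _)))
    _ = ((2 * C + 2) * ‖h.toH1‖) ^ 2 := by rw [← mul_add, ← norm_sq_eq_add, mul_pow]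

theorem abs_inner_le_of_mem_orthogonal_H10 {v : H1 d} (hv : v ∈ (H10 Ω')ᗮ) {p : E d} {r τ ε C : ℝ}
    (hε : 0 ≤ ε)
    (hvτ : ∀ φ, ∀ h : IsTestFunction (Metric.closedBall p τ) φ, |⟪h.toH1, v⟫_ℝ| ≤ ε * ‖h.toH1‖)
    (hσ : ContDiff ℝ ∞ σ) (hσ_one : ∀ x ∈ Metric.ball p r, σ x = 1)
    (hσ_zero : ∀ x ∉ Metric.ball p τ, σ x = 0)
    (hσ_norm : ∀ φ, ∀ h : IsTestFunction Ω φ, ‖(h.mul hσ).toH1‖ ≤ C * ‖h.toH1‖)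
    (hΩ : Ω \ Metric.ball p r ⊆ Ω') : ∀ u ∈ H10 Ω, |⟪u, v⟫_ℝ| ≤ ε * (C * ‖u‖) := by
  refine H10_induction (isClosed_le (by fun_prop) (by fun_prop)) fun φ h => ?_
  have hcompl : ContDiff ℝ ∞ fun x => 1 - σ x := contDiff_const.sub hσ
  have hout : IsTestFunction Ω' fun x => φ x * (1 - σ x) := by
    refine (h.mul hcompl).mono (Set.Subset.trans ?_ hΩ)
    refine Set.inter_subset_inter_right _ (closure_minimal (fun x hx hxr => hx ?_)
      Metric.isOpen_ball.isClosed_compl)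
    simp only [hσ_one x hxr, sub_self]
  have hin : IsTestFunction (Metric.closedBall p τ) fun x => φ x * σ x := by
    refine (h.mul hσ).mono (Set.inter_subset_right.trans (closure_minimal (fun x hx => ?_)
      Metric.isClosed_closedBall))
    exact Metric.ball_subset_closedBall (not_imp_comm.mp (hσ_zero x) hx)
  have hsplit : h.toH1 = hin.toH1 + hout.toH1 := h.toH1_eq_add hin hout (by
    ext x
    simp only [Pi.add_apply]
    ring)
  calc |⟪h.toH1, v⟫_ℝ| = |⟪hin.toH1, v⟫_ℝ| := by
        rw [hsplit, inner_add_left, (H10 Ω').inner_right_of_mem_orthogonal hout.toH1_mem_H10 hv,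
          add_zero]
    _ ≤ ε * ‖hin.toH1‖ := hvτ _ hin
    _ ≤ ε * (C * ‖h.toH1‖) := mul_le_mul_of_nonneg_left (hσ_norm φ h) hε

theorem mem_H10_of_forall_ball (hd : 2 ≤ d) {u : H1 d} {p : E d} {R : ℝ}
    (hu : ∀ r > 0, ∃ Ω ⊆ Metric.ball p R, u ∈ H10 Ω ∧ Ω \ Metric.ball p r ⊆ Ω') : u ∈ H10 Ω' := by
  have : CompleteSpace (H10 Ω') := (isClosed_H10 Ω').completeSpace_coe
  have : NeZero d := ⟨by lia⟩
  rw [← (H10 Ω').orthogonal_orthogonal]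
  refine (H10 Ω')ᗮ.mem_orthogonal' u |>.mpr fun v hv => ?_
  obtain ⟨C, hC₀, hC⟩ := exists_logCutoff (V := E d) (by simpa using hd) p R
  refine eq_of_abs_sub_le_all fun ε hε => ?_
  set A : ℝ := (2 * C + 2) * ‖u‖ + 1
  have hA₀ : 0 < A := by positivity
  obtain ⟨τ, hτ, hvτ⟩ := exists_forall_abs_inner_toH1_le v p (div_pos hε hA₀)
  obtain ⟨r, hr, σ, hσ, hσ_mem, hσ_one, hσ_zero, hσ_norm⟩ := hC τ hτ
  obtain ⟨Ω, hΩR, huΩ, hΩ⟩ := hu r hr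
  calc |⟪u, v⟫_ℝ - 0| ≤ ε / A * ((2 * C + 2) * ‖u‖) := by
        rw [sub_zero]
        exact abs_inner_le_of_mem_orthogonal_H10 hv (div_pos hε hA₀).le hvτ hσ hσ_one hσ_zero
          (fun φ h => h.norm_toH1_mul_le hσ hσ_mem hC₀.le
            (hσ_norm φ h.contDiff_one h.2.1 (h.2.2.trans hΩR))) hΩ u huΩ
    _ ≤ ε := by
        rw [div_mul_eq_mul_div, div_le_iff₀ hA₀]
        gcongr
        linarith

end Removability

section Continuity

variable {d : ℕ} {T : Type*} [LinearOrder T] [TopologicalSpace T] [OrderTopology T]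
  {Ω₀ Ω₁ : Set (E d)} {γ : T → E d}

theorem iInf_Ioi_H10_sweep_le (hd : 2 ≤ d) (hb₁ : Bornology.IsBounded Ω₁) (hsub : Ω₀ ⊆ Ω₁)
    (hγ : Continuous γ) {t : T} (ht : ¬IsMax t) :
    ⨅ s : Set.Ioi t, H10 (sweep Ω₀ Ω₁ γ s) ≤ H10 (sweep Ω₀ Ω₁ γ t) := by
  intro u hu
  obtain ⟨R, hR⟩ := hb₁.subset_ball (γ t)
  refine mem_H10_of_forall_ball hd (p := γ t) (R := R) fun r hr => ?_
  obtain ⟨s, hts, hs⟩ := exists_gt_sweep_diff_subset hγ ht (Metric.ball_mem_nhds (γ t) hr)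
  exact ⟨_, (sweep_subset hsub s).trans hR, (Submodule.mem_iInf _).mp hu ⟨s, hts⟩, hs⟩

variable [DenselyOrdered T] [CompactSpace T]

theorem H10_sweep_le_topologicalClosure_iSup_Iio (h₀ : IsOpen Ω₀) (h₁ : IsOpen Ω₁)
    (hγ : Continuous γ) {t : T} (ht : ¬IsMin t) : H10 (sweep Ω₀ Ω₁ γ t) ≤
      (⨆ s : Set.Iio t, H10 (sweep Ω₀ Ω₁ γ s)).topologicalClosure := by
  have : Nonempty (Set.Iio t) := nonempty_subtype.mpr (not_isMin_iff.mp ht)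
  exact (H10_mono (sweep_subset_iUnion_Iio hγ ht)).trans
    (H10_iUnion_le_topologicalClosure_iSup (fun s => isOpen_sweep h₀ h₁ hγ s)
      (monotone_sweep.comp (Subtype.mono_coe _)).directed_le)

theorem continuous_of_isSolution_sweep (hd : 2 ≤ d) (h₀ : IsOpen Ω₀) (h₁ : IsOpen Ω₁)
    (hb₁ : Bornology.IsBounded Ω₁) (hsub : Ω₀ ⊆ Ω₁) (hγ : Continuous γ) {f : L2 d} {u : T → H1 d}
    (hu : ∀ t, IsSolution (sweep Ω₀ Ω₁ γ t) f (u t)) : Continuous u := by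
  have : NeZero d := ⟨by lia⟩
  obtain ⟨R, hR, hΩR⟩ := hb₁.subset_ball_lt 0 0
  exact continuous_isGalerkinSolution (by positivity) (isClosed_H10 Ω₁)
    (norm_le_mul_norm_grad_of_mem_H10 hR hΩR) (fun _ _ hst => H10_mono (monotone_sweep hst))
    (fun t => H10_mono (sweep_subset hsub t)) (fun t => isClosed_H10 _)
    (fun t => H10_sweep_le_topologicalClosure_iSup_Iio h₀ h₁ hγ)
    (fun t => iInf_Ioi_H10_sweep_le hd hb₁ hsub hγ)
    fun t => isSolution_iff_isGalerkinSolution.mp (hu t)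

theorem gammaContinuous_of_continuous {Ω : unitInterval → Set (E d)}
    (hΩ : ∀ f : L2 d, ∃ u : unitInterval → H1 d,
      (∀ t, IsUniqueSolution (Ω t) f (u t)) ∧ Continuous u) : GammaContinuous Ω := by
  intro t t' ht f
  obtain ⟨u, hu, hcont⟩ := hΩ f
  exact ⟨fun n => u (t n), u t', fun n => hu (t n), hu t', fun ℓ =>
    ((ℓ.continuous.comp hcont).tendsto t').comp ht⟩

end Continuity

end Dirichlet

end

theorem theorem01 (d : ℕ) (hd : 2 ≤ d) (Ω₀ Ω₁ : Set (Dirichlet.E d))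
    (h₀ : IsOpen Ω₀) (h₁ : IsOpen Ω₁)
    (hb₀ : Bornology.IsBounded Ω₀) (hb₁ : Bornology.IsBounded Ω₁) (hsub : Ω₀ ⊆ Ω₁) :
    ∃ Ω : unitInterval → Set (Dirichlet.E d),
      Ω 0 = Ω₀ ∧ Ω 1 = Ω₁ ∧
      (∀ t, IsOpen (Ω t)) ∧
      (∀ s t, s < t → Ω s ⊆ Ω t) ∧
      Dirichlet.GammaContinuous Ω ∧
      -- moreover the solutions depend continuously on `t` in the norm of `H¹(ℝ^d)`
      (∀ f : Dirichlet.L2 d, ∃ u : unitInterval → Dirichlet.H1 d,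
        (∀ t, Dirichlet.IsUniqueSolution (Ω t) f (u t)) ∧ Continuous u) := by
  have : NeZero d := ⟨by lia⟩
  obtain ⟨q, hq⟩ : ∃ q, q ∉ Ω₁ :=
    (Set.ne_univ_iff_exists_notMem Ω₁).mp fun h => NormedSpace.unbounded_univ ℝ _ (h ▸ hb₁)
  obtain ⟨a, γ, hγ⟩ := Dirichlet.exists_path_range_superset hb₁ q
  have hsol : ∀ f : Dirichlet.L2 d, ∃ u : unitInterval → Dirichlet.H1 d,
      (∀ t, Dirichlet.IsUniqueSolution (Dirichlet.sweep Ω₀ Ω₁ γ t) f (u t)) ∧ Continuous u := by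
    intro f
    choose u hu using fun t => Dirichlet.exists_isUniqueSolution
      (hb₁.subset (Dirichlet.sweep_subset (γ := γ) hsub t)) f
    exact ⟨u, hu, Dirichlet.continuous_of_isSolution_sweep hd h₀ h₁ hb₁ hsub γ.continuous
      fun t => (hu t).1⟩
  exact ⟨Dirichlet.sweep Ω₀ Ω₁ γ, Dirichlet.sweep_eq_left hγ,
    Dirichlet.sweep_eq_right hsub (γ.target.symm ▸ hq),
    Dirichlet.isOpen_sweep h₀ h₁ γ.continuous, fun s t hst => Dirichlet.monotone_sweep hst.le,
    Dirichlet.gammaContinuous_of_continuous hsol, hsol⟩
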